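/- **Setting.** A family of *components* consists of sources (only output ports), channels (input and output ports) and measurements (only input ports), each port carrying a system type; every measurement outputs a bit. A *circuit* (wiring) consists of finitely many nodes, each a copy of a component (any component may be used any number of times), with wires from output ports to input ports of the same type, such that every input port receives exactly one wire, every output port emits at most one wire (it is discarded if it emits none; no fan-out), and there is no directed cycle. An *Operational Probabilistic Theory* (OPT) with these components assigns to every circuit a joint probability distribution of the bits output by its measurement nodes, depending only on the wiring. A *cause* of a node is a node from which a directed path of positive length leads to it; the *causal past* of a set of measurement nodes consists of these nodes and all their causes. The OPT satisfies - *No-Signaling* if the joint distribution of any measurement outcomes in any circuit depends only on their causal past: if in two circuits the causal pasts of two families of measurement nodes are the same wiring (up to naming of nodes, corresponding variables matching), the two joint distributions agree; - *Independence* if in every circuit, for any two families of measurement nodes with disjoint causal pasts, the joint distribution of all their outcomes is the product of the distributions of the two families; - the *Coordination Principle* if in every circuit any $N\ge 2$ distinct measurement nodes whose outcomes are perfectly coordinated (i.e. are all equal to one uniformly random bit) share a common cause (one node that is a cause of all of them). Let $\mathcal C$ be the following circuit. It has four sources $ABC, ABD, ACD, BCD$, six channels $AB, AC, AD, BC, BD,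 CD$ and four measurements $A,B,C,D$. There is one wire from each source to each of the three channels whose two parties belong to that source, and one wire from each channel to the measurements of each of its two parties. The wires have arbitrary prescribed system types (possibly all equal). The circuit defines a set of four sources, six channels and four measurements, whose ports are the ends of these wires. **Theorem.** For every choice of the system types, $A,B,C,D$ have no common cause in $\mathcal C$, and there is an OPT with exactly these four sources, six channels and four measurements that satisfies No-Signaling and Independence (for all circuits wired from arbitrarily many copies of the components), while its outcomes $a,b,c,d$ of $A,B,C,D$ in $\mathcal C$ are perfectly coordinated: $$P(a,b,c,d)=\begin{cases}1/2 & \text{if } a=b=c=d,\\ 0 & \text{otherwise.}\end{cases}$$ In particular this OPT violates the Coordination Principle, so the Coordination Principle does not follow from No-Signaling and Independence. -/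

import Mathlib

/-- The building blocks of an operational theory: sources (outputs only), channels (inputs and
outputs) and measurements (inputs only).  Every component has finitely many labelled ports, and
every port carries a system type. -/
structure Components where
  System : Type
  Source : Type
  Channel : Type
  Measurement : Type
  /-- All input ports, of all components. -/
  InPort : Type
  /-- All output ports, of all components. -/
  OutPort : Type
  /-- The component to which an input port belongs; sources have none. -/
  inOwner : InPort → Channel ⊕ Measurement
  /-- The component to which an output port belongs; measurements have none. -/
  outOwner : OutPort → Source ⊕ Channel
  inType : InPort → System
  outType : OutPort → System
  finite_in : ∀ c, {i | inOwner i = c}.Finite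
  finite_out : ∀ c, {o | outOwner o = c}.Finite

namespace Components

/-- A component of the theory. -/
inductive Comp (K : Components) : Type
  | source (s : K.Source)
  | channel (c : K.Channel)
  | measurement (m : K.Measurement)

variable (K : Components)

/-- The component that carries the input port `i`. -/
def inComp (i : K.InPort) : K.Comp := Sum.elim Comp.channel Comp.measurement (K.inOwner i)

/-- The component that carries the output port `o`. -/
def outComp (o : K.OutPort) : K.Comp := Sum.elim Comp.source Comp.channel (K.outOwner o)

end Components

/-- A circuit: finitely many nodes, each a copy of a component (a component may be used any number
of times), together with a wiring.  `conn m o n i` says that a wire goes from the output port `o`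
of the node `m` to the input port `i` of the node `n`.  Wires respect system types, every input port
receives exactly one wire, every output port emits at most one wire (it is discarded if it emits
none; there is no fan-out), and there are no causal loops. -/
structure Circuit (K : Components) where
  Node : Type
  finite_node : Finite Node
  label : Node → K.Comp
  conn : Node → K.OutPort → Node → K.InPort → Prop
  conn_out : ∀ {m o n i}, conn m o n i → K.outComp o = label m
  conn_in : ∀ {m o n i}, conn m o n i → K.inComp i = label n
  conn_type : ∀ {m o n i}, conn m o n i → K.outType o = K.inType i
  in_existsUnique : ∀ n i, K.inComp i = label n → ∃! p : Node × K.OutPort, conn p.1 p.2 n i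
  out_unique : ∀ {m o n i n' i'}, conn m o n i → conn m o n' i' → n = n' ∧ i = i'
  acyclic : ∀ n, ¬ Relation.TransGen (fun m n => ∃ o i, conn m o n i) n n

namespace Circuit

variable {K : Components} (C : Circuit K)

/-- Some wire goes from `m` to `n`. -/
def Edge (m n : C.Node) : Prop := ∃ o i, C.conn m o n i

/-- `m` is a (direct or indirect) cause of `n`: there is a directed path from `m` to `n`. -/
def Causes (m n : C.Node) : Prop := Relation.TransGen C.Edge m n

/-- The measurement nodes; each of them carries one output variable, a bit. -/
def MeasNode : Type := {n : C.Node // ∃ m, C.label n = Components.Comp.measurement m}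

/-- The causal past of a family of variables: their nodes and all the causes of these. -/
def past {ι : Type} (x : ι → C.MeasNode) : Set C.Node :=
  {n | ∃ j, n = (x j).1 ∨ C.Causes n (x j).1}

theorem mem_past {ι : Type} (x : ι → C.MeasNode) (j : ι) : (x j).1 ∈ C.past x :=
  ⟨j, Or.inl rfl⟩

/-- The variables `x` all share a common cause: one node is a cause of each of them. -/
def HasCommonCause {ι : Type} (x : ι → C.MeasNode) : Prop :=
  ∃ n, ∀ j, C.Causes n (x j).1

/-- `C` and `C'` are the same wiring, up to the names of the nodes. -/
structure Iso (C C' : Circuit K) where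
  toEquiv : C.Node ≃ C'.Node
  label_eq : ∀ n, C'.label (toEquiv n) = C.label n
  conn_iff : ∀ m o n i, C'.conn (toEquiv m) o (toEquiv n) i ↔ C.conn m o n i

/-- The map that an isomorphism of circuits induces on measurement nodes. -/
def Iso.meas {C C' : Circuit K} (e : Iso C C') (n : C.MeasNode) : C'.MeasNode :=
  ⟨e.toEquiv n.1, n.2.imp fun _ h => (e.label_eq n.1).trans h⟩

/-- The variables `x` of `C` and `x'` of `C'` have the same causal past: the subcircuits formed
by these pasts are the same wiring up to the names of the nodes, with `x j` corresponding to
`x' j`. What else is in the circuits, and where other outputs of the pasts lead, is irrelevant. -/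
structure PastIso (C C' : Circuit K) {ι : Type} (x : ι → C.MeasNode) (x' : ι → C'.MeasNode) where
  toEquiv : C.past x ≃ C'.past x'
  label_eq : ∀ n, C'.label (toEquiv n) = C.label n
  conn_iff : ∀ m o n i, C'.conn (toEquiv m) o (toEquiv n) i ↔ C.conn m o n i
  map_var : ∀ j, toEquiv ⟨(x j).1, C.mem_past x j⟩ = ⟨(x' j).1, C'.mem_past x' j⟩

end Circuit

/-- An operational probabilistic theory with components `K` and binary measurements: it assigns to
every circuit that can be wired from copies of the components a joint probability distribution of
the outcomes of its measurement nodes, and this distribution depends only on the wiring. -/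
structure OPT (K : Components) where
  prob : ∀ C : Circuit K, PMF (C.MeasNode → Bool)
  prob_iso : ∀ (C C' : Circuit K) (e : Circuit.Iso C C'),
    (prob C').map (fun ω n => ω (e.meas n)) = prob C

namespace OPT

variable {K : Components} (T : OPT K)

/-- The joint (marginal) distribution of a family of variables of a circuit. -/
noncomputable def law (C : Circuit K) {ι : Type} (x : ι → C.MeasNode) : PMF (ι → Bool) :=
  (T.prob C).map (fun ω j => ω (x j))

/-- No-Signaling: the joint distribution of any variables is determined by their causal past; it
cannot be altered by any modification of the circuit outside of that past. -/
def NoSignaling : Prop :=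
  ∀ (C C' : Circuit K) (ι : Type) [Finite ι] (x : ι → C.MeasNode) (x' : ι → C'.MeasNode),
    Nonempty (Circuit.PastIso C C' x x') → T.law C x = T.law C' x'

/-- Independence: two (possibly composite) variables `x` and `y` that do not share a common cause
are uncorrelated, i.e. their joint distribution is the product of their distributions. -/
def Independence : Prop :=
  ∀ (C : Circuit K) (ι κ : Type) [Finite ι] [Finite κ] (x : ι → C.MeasNode) (y : κ → C.MeasNode),
    Disjoint (C.past x) (C.past y) →
      ∀ (f : ι → Bool) (g : κ → Bool),
        T.law C (Sum.elim x y) (Sum.elim f g) = T.law C x f * T.law C y g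

/-- The variables `x` are perfectly coordinated: they realize a shared uniformly random bit. -/
def Coordinated (C : Circuit K) {ι : Type} [Fintype ι] (x : ι → C.MeasNode) : Prop :=
  ∀ f : ι → Bool, T.law C x f = if ∀ j k, f j = f k then 1 / 2 else 0

/-- The Coordination Principle: any `N ≥ 2` distinct perfectly coordinated variables, in any
circuit, share a common cause. -/
def CoordinationPrinciple : Prop :=
  ∀ (C : Circuit K) (ι : Type) [Fintype ι] [Nontrivial ι] (x : ι → C.MeasNode),
    Function.Injective x → T.Coordinated C x → C.HasCommonCause x

end OPT

namespace FourParty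

inductive Party
  | A | B | C | D
  deriving DecidableEq

instance : Fintype Party :=
  ⟨{Party.A, Party.B, Party.C, Party.D}, by intro x; cases x <;> decide⟩

/-- The sources `ABC`, `ABD`, `ACD`, `BCD`. -/
abbrev Source : Type := {s : Finset Party // s.card = 3}

/-- The channels `AB`, `AC`, `AD`, `BC`, `BD`, `CD`. -/
abbrev Channel : Type := {c : Finset Party // c.card = 2}

/-- The wires of the four-party circuit: from each source to the channels whose two parties belong
to the source, and from each channel to the measurements of its two parties. -/
inductive Wire
  | toChannel (s : Source) (c : Channel) (h : c.1 ⊆ s.1)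
  | toMeasurement (c : Channel) (p : Party) (h : p ∈ c.1)

/-- The component in which a wire ends. -/
def Wire.target : Wire → Channel ⊕ Party
  | .toChannel _ c _ => Sum.inl c
  | .toMeasurement _ p _ => Sum.inr p

/-- The component from which a wire starts. -/
def Wire.origin : Wire → Source ⊕ Channel
  | .toChannel s _ _ => Sum.inl s
  | .toMeasurement c _ _ => Sum.inr c

theorem finite_wire : Finite Wire := by
  let F : Wire → (Source × Channel) ⊕ (Channel × Party) := fun w => match w with
    | .toChannel s c _ => Sum.inl (s, c)
    | .toMeasurement c p _ => Sum.inr (c, p)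
  refine Finite.of_injective F ?_
  rintro (⟨s, c, h⟩ | ⟨c, p, h⟩) (⟨s', c', h'⟩ | ⟨c', p', h'⟩) e <;> simp_all [F]

/-- The four sources, six channels and four measurements.  Each component has one port for every
wire of the four-party circuit at that component; `τ` prescribes the system types of these wires.
(For constant `τ` every output port may be plugged into every input port.) -/
def components (System : Type) (τ : Wire → System) : Components where
  System := System
  Source := Source
  Channel := Channel
  Measurement := Party
  InPort := Wire
  OutPort := Wire
  inOwner := Wire.target
  outOwner := Wire.origin
  inType := τ
  outType := τ
  finite_in _ := by have := finite_wire; exact Set.toFinite _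
  finite_out _ := by have := finite_wire; exact Set.toFinite _

/-- The layer of a component: sources, then channels, then measurements. -/
def layer {System : Type} {τ : Wire → System} : (components System τ).Comp → ℕ
  | .source _ => 0
  | .channel _ => 1
  | .measurement _ => 2

theorem layer_lt {System : Type} {τ : Wire → System} (w : Wire) :
    layer ((components System τ).outComp w) < layer ((components System τ).inComp w) := by
  cases w
  · exact Nat.zero_lt_one
  · exact Nat.one_lt_two

/-- The four-party circuit: one copy of every component, and all the wires. -/
def circuit (System : Type) (τ : Wire → System) : Circuit (components System τ) where
  Node := (components System τ).Comp
  finite_node := by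
    let F : (components System τ).Comp → Source ⊕ (Channel ⊕ Party) := fun c => match c with
      | .source s => Sum.inl s
      | .channel c => Sum.inr (Sum.inl c)
      | .measurement m => Sum.inr (Sum.inr m)
    refine Finite.of_injective F ?_
    rintro (s | s | s) (t | t | t) e <;> cases e <;> rfl
  label := id
  conn m o n i := o = i ∧ (components System τ).outComp o = m ∧ (components System τ).inComp i = n
  conn_out h := h.2.1
  conn_in h := h.2.2
  conn_type h := congrArg τ h.1
  in_existsUnique n i h := by
    refine ⟨((components System τ).outComp i, i), ⟨rfl, rfl, h⟩, ?_⟩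
    rintro ⟨m, o⟩ ⟨h1, h2, -⟩
    dsimp only at h1 h2
    subst h1
    rw [h2]
  out_unique := by
    rintro m o n i n' i' ⟨rfl, -, rfl⟩ ⟨rfl, -, rfl⟩
    exact ⟨rfl, rfl⟩
  acyclic n h := by
    have key : ∀ a b, Relation.TransGen (fun m n : (components System τ).Comp => ∃ o i : Wire,
        o = i ∧ (components System τ).outComp o = m ∧ (components System τ).inComp i = n) a b →
        layer a < layer b := by
      intro a b hab
      induction hab with
      | single h =>
        obtain ⟨o, i, rfl, rfl, rfl⟩ := h
        exact layer_lt o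
      | tail _ h ih =>
        obtain ⟨o, i, rfl, rfl, rfl⟩ := h
        exact ih.trans (layer_lt o)
    exact lt_irrefl _ (key n n h)

/-- The output variable of the party `p` (`a`, `b`, `c` or `d`) in the four-party circuit. -/
def output (System : Type) (τ : Wire → System) (p : Party) : (circuit System τ).MeasNode :=
  ⟨Components.Comp.measurement p, p, rfl⟩

end FourParty

/-! Measurement nodes carry fair bits, shared exactly between linked nodes and independent across
link classes. Two distinct nodes are linked when their joint past looks like that of two parties in
the four-party circuit. A link depends only on the joint past, which gives No-Signaling. Linked
nodes have a common channel in their pasts, so disjoint pasts meet disjoint sets of classes, which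
gives Independence. In the four-party circuit all outputs are linked, yet each source reaches only
three parties.

The crux is that linking is transitive (`Linked.trans`). If `p`, `q` and `q`, `r` are linked, the
input wires of the shared node `q` determine the source `pqr`. As there is no fan-out, that source
feeds only one channel `pr`, so the two partial copies glue to a link between `p` and `r`. This
needs every three parties to share a source, but no source common to all four. -/

open scoped Classical in
/-- Independent uniformly random bits indexed by `Q`. -/
noncomputable def PMF.uniformBits (Q : Type) [Fintype Q] : PMF (Q → Bool) :=
  PMF.uniformOfFintype (Q → Bool)

open scoped Classical in
/-- Independent uniform bits indexed by `Q`, read off along `g : ι → Q`. -/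
theorem PMF.map_uniformBits_apply {ι Q : Type} [Fintype Q] (g : ι → Q) (f : ι → Bool) :
    (PMF.map (fun (ω : Q → Bool) j => ω (g j)) (PMF.uniformBits Q)) f =
      if ∀ i j, g i = g j → f i = f j then (2⁻¹ : ENNReal) ^ (Set.range g).ncard else 0 := by
  rw [PMF.map_apply, tsum_fintype]
  split_ifs with h
  · let f₀ : {q // q ∈ Set.range g} → Bool := fun q => f q.2.choose
    have hf₀ : ∀ ω : Q → Bool, (f = fun j => ω (g j)) ↔ ω ∘ Subtype.val = f₀ := by
      intro ω
      constructor
      · rintro e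
        funext ⟨q, hq⟩
        have := congrFun e hq.choose
        simp only [hq.choose_spec] at this
        exact this.symm
      · intro e
        funext j
        have := congrFun e ⟨g j, j, rfl⟩
        refine (h _ _ ?_).trans this.symm
        exact (Set.mem_range_self (f := g) j).choose_spec.symm
    -- The bits on the range of `g` are forced and those off it are free.
    have hcard : (Finset.univ.filter fun ω : Q → Bool => ω ∘ Subtype.val = f₀).card =
        2 ^ Fintype.card {q // q ∉ Set.range g} := by
      rw [← Fintype.card_subtype,
        Fintype.card_congr (Equiv.subtypePreimage (fun q => q ∈ Set.range g) f₀)]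
      simp
    have hsum : Fintype.card Q =
        (Set.range g).ncard + Fintype.card {q // q ∉ Set.range g} := by
      rw [← Nat.card_coe_set_eq, Nat.card_eq_fintype_card,
        Fintype.card_congr (Equiv.sumCompl fun q => q ∈ Set.range g).symm, Fintype.card_sum]
    simp only [PMF.uniformBits, PMF.uniformOfFintype_apply, hf₀]
    rw [← Finset.sum_filter, Finset.sum_const, hcard, Fintype.card_fun, Fintype.card_bool, hsum,
      nsmul_eq_mul, pow_add]
    push_cast
    rw [ENNReal.mul_inv (Or.inl (by simp)) (Or.inl (by simp)), mul_left_comm,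
      ENNReal.mul_inv_cancel (by simp) (by simp), mul_one, ENNReal.inv_pow]
  · refine Finset.sum_eq_zero fun ω _ => if_neg ?_
    rintro rfl
    exact h fun i j e => congrArg ω e

theorem Set.ncard_range_eq_of_eq_iff {ι Q Q' : Type} (g : ι → Q) (g' : ι → Q')
    (h : ∀ i j, g i = g j ↔ g' i = g' j) : (Set.range g).ncard = (Set.range g').ncard := by
  have hker : Setoid.ker g = Setoid.ker g' := Setoid.ext fun i j => h i j
  rw [← Nat.card_coe_set_eq, ← Nat.card_coe_set_eq]
  exact Nat.card_congr ((Setoid.quotientKerEquivRange g).symm.trans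
    ((Quotient.congrRight fun i j => h i j).trans (Setoid.quotientKerEquivRange g')))

/-! ### Causal pasts and isomorphisms. -/

theorem Circuit.past_closed {K : Components} (C : Circuit K) {ι : Type} {x : ι → C.MeasNode}
    {m n : C.Node} (h : C.Edge m n) (hn : n ∈ C.past x) : m ∈ C.past x := by
  obtain ⟨j, rfl | hj⟩ := hn
  · exact ⟨j, Or.inr (.single h)⟩
  · exact ⟨j, Or.inr (.head h hj)⟩

theorem Circuit.origin_eq_of_conn {K : Components} (C : Circuit K) {m m' n : C.Node} {o o' i}
    (h : C.conn m o n i) (h' : C.conn m' o' n i) : m = m' :=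
  congrArg Prod.fst ((C.in_existsUnique n i (C.conn_in h)).unique
    (y₁ := (m, o)) (y₂ := (m', o')) h h')

/-- The inverse of an isomorphism of causal pasts. -/
def Circuit.PastIso.symm {K : Components} {C C' : Circuit K} {ι : Type} {x : ι → C.MeasNode}
    {x' : ι → C'.MeasNode} (e : Circuit.PastIso C C' x x') : Circuit.PastIso C' C x' x where
  toEquiv := e.toEquiv.symm
  label_eq n := by rw [← e.label_eq, Equiv.apply_symm_apply]
  conn_iff m o n i := by rw [← e.conn_iff, Equiv.apply_symm_apply, Equiv.apply_symm_apply]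
  map_var j := by rw [← e.map_var, Equiv.symm_apply_apply]

/-- The inverse of an isomorphism of circuits. -/
def Circuit.Iso.symm {K : Components} {C C' : Circuit K} (e : Circuit.Iso C C') :
    Circuit.Iso C' C where
  toEquiv := e.toEquiv.symm
  label_eq n := by rw [← e.label_eq, Equiv.apply_symm_apply]
  conn_iff m o n i := by rw [← e.conn_iff, Equiv.apply_symm_apply, Equiv.apply_symm_apply]

/-! ### Partial copies of the four-party circuit inside an arbitrary circuit. -/

namespace FourParty

variable {System : Type} {τ : Wire → System}

/-- The parties that a component concerns. -/
def parties : (components System τ).Comp → Finset Party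
  | .source s => s.1
  | .channel c => c.1
  | .measurement p => {p}

/-- `φ` maps the wires in the past of the party `p` of the four-party circuit to wires of `C`. -/
def IsPastHom (C : Circuit (components System τ)) (φ : (components System τ).Comp → C.Node)
    (p : Party) : Prop :=
  ∀ w : Wire, p ∈ parties ((components System τ).inComp w) →
    C.conn (φ ((components System τ).outComp w)) w (φ ((components System τ).inComp w)) w

/-- Two nodes are linked if they coincide or their joint past is a copy of the joint past of two
parties in the four-party circuit. -/
def Linked (C : Circuit (components System τ)) (n m : C.Node) : Prop :=
  n = m ∨ ∃ φ p q, IsPastHom C φ p ∧ IsPastHom C φ q ∧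
    φ (.measurement p) = n ∧ φ (.measurement q) = m

theorem exists_channel (p q : Party) : ∃ c : Channel, p ∈ c.1 ∧ q ∈ c.1 := by
  obtain ⟨c, hc, h2⟩ := Finset.exists_superset_card_eq (s := ({p, q} : Finset Party)) (n := 2)
    Finset.card_le_two (by decide)
  exact ⟨⟨c, h2⟩, hc (by simp), hc (by simp)⟩

section PastHom

variable {C : Circuit (components System τ)} {φ ψ : (components System τ).Comp → C.Node}
  {p q r : Party}

theorem IsPastHom.channel_measurement (h : IsPastHom C φ p) (c : Channel) (hc : p ∈ c.1) :
    C.conn (φ (.channel c)) (.toMeasurement c p hc) (φ (.measurement p)) (.toMeasurement c p hc) :=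
  h (.toMeasurement c p hc) (Finset.mem_singleton_self p)

theorem IsPastHom.source_channel (h : IsPastHom C φ p) (s : Source) (c : Channel) (hcs : c.1 ⊆ s.1)
    (hc : p ∈ c.1) :
    C.conn (φ (.source s)) (.toChannel s c hcs) (φ (.channel c)) (.toChannel s c hcs) :=
  h (.toChannel s c hcs) hc

/-- Backward propagation: an input port receives only one wire. -/
theorem IsPastHom.channel_eq (h : IsPastHom C φ p) (h' : IsPastHom C ψ p)
    (e : φ (.measurement p) = ψ (.measurement p)) (c : Channel) (hc : p ∈ c.1) :
    φ (.channel c) = ψ (.channel c) :=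
  Circuit.origin_eq_of_conn C (h.channel_measurement c hc) (e ▸ h'.channel_measurement c hc)

theorem IsPastHom.source_eq_of_channel_eq (h : IsPastHom C φ p) (h' : IsPastHom C ψ r) {c : Channel}
    (e : φ (.channel c) = ψ (.channel c)) (hp : p ∈ c.1) (hr : r ∈ c.1) {s : Source}
    (hcs : c.1 ⊆ s.1) : φ (.source s) = ψ (.source s) :=
  Circuit.origin_eq_of_conn C (h.source_channel s c hcs hp) (e ▸ h'.source_channel s c hcs hr)

/-- Forward propagation: without fan-out, an output port reaches only one node. -/
theorem IsPastHom.channel_eq_of_source_eq (h : IsPastHom C φ p) (h' : IsPastHom C ψ r) {s : Source}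
    (e : φ (.source s) = ψ (.source s)) {c : Channel} (hcs : c.1 ⊆ s.1) (hp : p ∈ c.1)
    (hr : r ∈ c.1) : φ (.channel c) = ψ (.channel c) :=
  (C.out_unique (h.source_channel s c hcs hp) (e ▸ h'.source_channel s c hcs hr)).1

theorem IsPastHom.measurement_eq_of_channel_eq (h : IsPastHom C φ p) (h' : IsPastHom C ψ p)
    {c : Channel} (e : φ (.channel c) = ψ (.channel c)) (hp : p ∈ c.1) :
    φ (.measurement p) = ψ (.measurement p) :=
  (C.out_unique (h.channel_measurement c hp) (e ▸ h'.channel_measurement c hp)).1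

theorem IsPastHom.congr (h : IsPastHom C φ p) (e : ∀ k, p ∈ parties k → φ k = ψ k) :
    IsPastHom C ψ p := by
  intro w hw
  rw [← e _ hw, ← e]
  · exact h w hw
  · cases w with
    | toChannel s c hcs => exact hcs hw
    | toMeasurement c p' hp => exact Finset.mem_singleton.1 hw ▸ hp

/-- Two partial copies of the four-party circuit that share the measurement `q` agree wherever both
are determined. -/
theorem IsPastHom.eq_of_mem (hp : IsPastHom C φ p) (hq : IsPastHom C φ q) (hq' : IsPastHom C ψ q)
    (hr : IsPastHom C ψ r) (e : φ (.measurement q) = ψ (.measurement q)) (hpq : p ≠ q)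
    (hqr : q ≠ r) (k : (components System τ).Comp) (hkp : p ∈ parties k) (hkr : r ∈ parties k) :
    φ k = ψ k := by
  have pair : ∀ a b : Party, a ≠ b → ({a, b} : Finset Party).card = 2 := fun a b h =>
    Finset.card_pair h
  by_cases hpr : p = r
  · subst hpr
    -- Back from `q` to the channel `pq`, then forward to the measurement `p`, which determines its
    -- whole past.
    have e₁ := hq.channel_eq hq' e ⟨{p, q}, pair p q hpq⟩ (by simp)
    have e₂ := hp.measurement_eq_of_channel_eq hr e₁ (by simp)
    have e₃ := fun c hc => hp.channel_eq hr e₂ c hc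
    match k, hkp with
    | .measurement p', hk => rw [← Finset.mem_singleton.1 hk]; exact e₂
    | .channel c, hk => exact e₃ c hk
    | .source s, hk =>
      obtain ⟨b, hb, hbp⟩ := Finset.exists_mem_ne (by rw [s.2]; norm_num) p
      refine hp.source_eq_of_channel_eq hr (e₃ ⟨{p, b}, pair p b hbp.symm⟩ (by simp)) (by simp)
        (by simp) ?_
      exact Finset.insert_subset hk (Finset.singleton_subset_iff.2 hb)
  · let c₀ : Channel := ⟨{p, r}, pair p r hpr⟩
    let s₀ : Source := ⟨{p, q, r}, Finset.card_eq_three.2 ⟨p, q, r, hpq, hpr, hqr, rfl⟩⟩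
    -- Back from `q` through `pq` to the source `pqr`, then forward to the channel `pr`. The inputs
    -- of `pr` also determine the other source containing `p` and `r`.
    have e₁ := hq.channel_eq hq' e ⟨{p, q}, pair p q hpq⟩ (by simp)
    have e₂ : φ (.source s₀) = ψ (.source s₀) :=
      hq.source_eq_of_channel_eq hq' e₁ (by simp) (by simp) (by
        intro a; simp only [s₀, Finset.mem_insert, Finset.mem_singleton]; tauto)
    have e₃ : φ (.channel c₀) = ψ (.channel c₀) :=
      hp.channel_eq_of_source_eq hr e₂ (by
        intro a; simp only [c₀, s₀, Finset.mem_insert, Finset.mem_singleton]; tauto)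
        (by simp [c₀]) (by simp [c₀])
    match k, hkp, hkr with
    | .measurement p', hk, hk' =>
      exact absurd ((Finset.mem_singleton.1 hk).trans (Finset.mem_singleton.1 hk').symm) hpr
    | .channel c, hk, hk' =>
      have : c₀ = c := Subtype.ext (Finset.eq_of_subset_of_card_le
        (Finset.insert_subset hk (Finset.singleton_subset_iff.2 hk')) (by rw [c.2, c₀.2]))
      exact this ▸ e₃
    | .source s, hk, hk' =>
      exact hp.source_eq_of_channel_eq hr e₃ (by simp [c₀]) (by simp [c₀])
        (Finset.insert_subset hk (Finset.singleton_subset_iff.2 hk'))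

/-- The past of the party `p` is mapped into the past of its image. -/
theorem IsPastHom.mem_of_closed (h : IsPastHom C φ p) {S : Set C.Node}
    (hS : ∀ m n, C.Edge m n → n ∈ S → m ∈ S) (hp : φ (.measurement p) ∈ S) (w : Wire)
    (hw : p ∈ parties ((components System τ).inComp w)) :
    φ ((components System τ).outComp w) ∈ S ∧ φ ((components System τ).inComp w) ∈ S := by
  have hin : φ ((components System τ).inComp w) ∈ S := by
    cases w with
    | toChannel s c hcs => exact hS _ _ ⟨_, _, h.channel_measurement c hw⟩ hp
    | toMeasurement c p' hp' =>
      obtain rfl : p = p' := Finset.mem_singleton.1 hw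
      exact hp
  exact ⟨hS _ _ ⟨_, _, h w hw⟩ hin, hin⟩

end PastHom

/-! ### Linking is an equivalence relation determined by the past. -/

section Linked

variable {C C' : Circuit (components System τ)}

theorem Linked.symm {n m : C.Node} (h : Linked C n m) : Linked C m n := by
  obtain rfl | ⟨φ, p, q, hp, hq, rfl, rfl⟩ := h
  · exact Or.inl rfl
  · exact Or.inr ⟨φ, q, p, hq, hp, rfl, rfl⟩

open scoped Classical in
theorem Linked.trans {n m l : C.Node} (h : Linked C n m) (h' : Linked C m l) : Linked C n l := by
  obtain rfl | ⟨φ, p, q, hp, hq, rfl, rfl⟩ := h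
  · exact h'
  obtain e | ⟨ψ, q', r, hq', hr, e, rfl⟩ := h'
  · exact Or.inr ⟨φ, p, q, hp, hq, rfl, e⟩
  -- The label of the shared node tells which party it is.
  obtain rfl : q' = q := by
    have h₁ := C.conn_in (hq.channel_measurement _ (exists_channel q q).choose_spec.1)
    have h₂ := C.conn_in (hq'.channel_measurement _ (exists_channel q' q').choose_spec.1)
    rw [e, ← h₁] at h₂
    injection h₂
  by_cases hpq : p = q'
  · subst hpq
    exact Or.inr ⟨ψ, p, r, hq', hr, e, rfl⟩
  by_cases hqr : q' = r
  · subst hqr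
    exact Or.inr ⟨φ, p, q', hp, hq, rfl, e.symm⟩
  have agree := hp.eq_of_mem hq hq' hr e.symm hpq hqr
  -- The past of a party involves only components containing it, so `χ` must match `φ` on those
  -- containing `p` and `ψ` on those containing `r`; `agree` covers the overlap.
  let χ : (components System τ).Comp → C.Node := fun k => if p ∈ parties k then φ k else ψ k
  have hφ : ∀ k, p ∈ parties k → φ k = χ k := fun k hk => (if_pos hk).symm
  have hψ : ∀ k, r ∈ parties k → ψ k = χ k := by
    intro k hk
    by_cases hk' : p ∈ parties k
    · rw [← hφ k hk', agree k hk' hk]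
    · exact (if_neg hk').symm
  exact Or.inr ⟨χ, p, r, hp.congr hφ, hr.congr hψ,
    (hφ (.measurement p) (Finset.mem_singleton_self p)).symm,
    (hψ (.measurement r) (Finset.mem_singleton_self r)).symm⟩

/-- Links are preserved by maps that preserve the wires in the past. -/
theorem Linked.map {n m : C.Node} (h : Linked C n m) (S : Set C.Node)
    (hS : ∀ a b, C.Edge a b → b ∈ S → a ∈ S) (hn : n ∈ S) (hm : m ∈ S) (F : C.Node → C'.Node)
    (hF : ∀ a ∈ S, ∀ b ∈ S, ∀ o i, C.conn a o b i → C'.conn (F a) o (F b) i) :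
    Linked C' (F n) (F m) := by
  obtain rfl | ⟨φ, p, q, hp, hq, rfl, rfl⟩ := h
  · exact Or.inl rfl
  refine Or.inr ⟨F ∘ φ, p, q, fun w hw => ?_, fun w hw => ?_, rfl, rfl⟩
  · obtain ⟨h₁, h₂⟩ := hp.mem_of_closed hS hn w hw
    exact hF _ h₁ _ h₂ _ _ (hp w hw)
  · obtain ⟨h₁, h₂⟩ := hq.mem_of_closed hS hm w hw
    exact hF _ h₁ _ h₂ _ _ (hq w hw)

open scoped Classical in
theorem Linked.map_pastIso {ι : Type} {x : ι → C.MeasNode} {x' : ι → C'.MeasNode}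
    (e : Circuit.PastIso C C' x x') {i j : ι} (h : Linked C (x i).1 (x j).1) :
    Linked C' (x' i).1 (x' j).1 := by
  -- The value outside the past is arbitrary.
  let F : C.Node → C'.Node := fun n => if hn : n ∈ C.past x then e.toEquiv ⟨n, hn⟩ else (x' i).1
  have hF : ∀ n (hn : n ∈ C.past x), F n = e.toEquiv ⟨n, hn⟩ := fun n hn => dif_pos hn
  have hx : ∀ j, F (x j).1 = (x' j).1 := fun j => by rw [hF _ (C.mem_past x j), e.map_var]
  rw [← hx i, ← hx j]
  refine h.map (C.past x) (fun _ _ => C.past_closed) (C.mem_past x i) (C.mem_past x j) F ?_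
  intro a ha b hb o i hab
  rw [hF a ha, hF b hb, e.conn_iff]
  exact hab

theorem Linked.map_iso (e : Circuit.Iso C C') {n m : C.Node} (h : Linked C n m) :
    Linked C' (e.toEquiv n) (e.toEquiv m) :=
  h.map Set.univ (fun _ _ _ _ => trivial) trivial trivial e.toEquiv fun a _ b _ o i hab =>
    (e.conn_iff a o b i).2 hab

/-- Linked variables have a common node in their pasts. -/
theorem Linked.not_disjoint_past {ι κ : Type} {x : ι → C.MeasNode} {y : κ → C.MeasNode} {i : ι}
    {j : κ} (h : Linked C (x i).1 (y j).1) : ¬ Disjoint (C.past x) (C.past y) := by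
  rw [Set.not_disjoint_iff]
  obtain e | ⟨φ, p, q, hp, hq, ep, eq⟩ := h
  · exact ⟨_, C.mem_past x i, e ▸ C.mem_past y j⟩
  obtain ⟨c, hcp, hcq⟩ : ∃ c : Channel, p ∈ c.1 ∧ q ∈ c.1 := exists_channel p q
  refine ⟨φ (.channel c), ⟨i, Or.inr ?_⟩, ⟨j, Or.inr ?_⟩⟩
  · exact ep ▸ .single ⟨_, _, hp.channel_measurement c hcp⟩
  · exact eq ▸ .single ⟨_, _, hq.channel_measurement c hcq⟩

end Linked

/-! ### The theory of shared bits and its properties. -/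

/-- Two variables of a circuit are linked if their nodes are. -/
def LinkedVars (C : Circuit (components System τ)) (n m : C.MeasNode) : Prop :=
  Linked C n.1 m.1

/-- The variables of a circuit, up to links. -/
def linkSetoid (C : Circuit (components System τ)) : Setoid C.MeasNode where
  r := LinkedVars C
  iseqv := ⟨fun _ => Or.inl rfl, fun h => Linked.symm h, fun h h' => Linked.trans h h'⟩

instance finite_quotient_linkSetoid (C : Circuit (components System τ)) :
    Finite (Quotient (linkSetoid C)) :=
  have := C.finite_node
  have : Finite C.MeasNode := Subtype.finite
  inferInstance

noncomputable instance fintype_quotient_linkSetoid (C : Circuit (components System τ)) :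
    Fintype (Quotient (linkSetoid C)) :=
  Fintype.ofFinite _

/-- The distribution in which linked variables share a uniformly random bit, and the bits of
different classes of variables are independent. -/
noncomputable def linkedBits (C : Circuit (components System τ)) : PMF (C.MeasNode → Bool) :=
  (PMF.uniformBits (Quotient (linkSetoid C))).map
    fun ω n => ω (Quotient.mk (linkSetoid C) n)

open scoped Classical in
theorem linkedBits_map_apply (C : Circuit (components System τ)) {ι : Type} (x : ι → C.MeasNode)
    (f : ι → Bool) :
    ((linkedBits C).map fun ω j => ω (x j)) f =
      if ∀ i j, LinkedVars C (x i) (x j) → f i = f j then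
        (2⁻¹ : ENNReal) ^ (Set.range fun j => Quotient.mk (linkSetoid C) (x j)).ncard else 0 := by
  rw [linkedBits, PMF.map_comp]
  refine (PMF.map_uniformBits_apply (fun j => Quotient.mk (linkSetoid C) (x j)) f).trans ?_
  have hq : ∀ i j, Quotient.mk (linkSetoid C) (x i) = Quotient.mk (linkSetoid C) (x j) ↔
      LinkedVars C (x i) (x j) := fun i j => Quotient.eq
  exact if_congr (forall₂_congr fun i j => imp_congr_left (hq i j)) rfl rfl

open scoped Classical in
theorem linkedBits_map_congr (C C' : Circuit (components System τ)) {ι : Type} (x : ι → C.MeasNode)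
    (x' : ι → C'.MeasNode)
    (h : ∀ i j, LinkedVars C (x i) (x j) ↔ LinkedVars C' (x' i) (x' j)) :
    ((linkedBits C).map fun ω j => ω (x j)) = (linkedBits C').map fun ω j => ω (x' j) := by
  ext f
  rw [linkedBits_map_apply, linkedBits_map_apply, Set.ncard_range_eq_of_eq_iff _
    (fun j => Quotient.mk (linkSetoid C') (x' j)) fun i j => ?_]
  · exact if_congr (forall₂_congr fun i j => imp_congr_left (h i j)) rfl rfl
  · rw [Quotient.eq, Quotient.eq]
    exact h i j

/-- The theory in which linked variables share a uniformly random bit. -/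
noncomputable def linkedTheory (System : Type) (τ : Wire → System) :
    OPT (components System τ) where
  prob := linkedBits
  prob_iso C C' e := by
    refine (linkedBits_map_congr C C' id e.meas fun n m =>
      ⟨fun h => Linked.map_iso e h, fun h => ?_⟩).symm.trans (PMF.map_id _)
    have := Linked.map_iso e.symm h
    simpa [LinkedVars, Circuit.Iso.meas, Circuit.Iso.symm] using this

theorem linkedTheory_noSignaling : (linkedTheory System τ).NoSignaling := by
  rintro C C' ι _ x x' ⟨e⟩
  exact linkedBits_map_congr C C' x x' fun i j =>
    ⟨fun h => Linked.map_pastIso e h, fun h => Linked.map_pastIso e.symm h⟩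

open scoped Classical in
theorem linkedTheory_independence : (linkedTheory System τ).Independence := by
  intro C ι κ _ _ x y hxy f g
  have hno : ∀ i j, ¬ LinkedVars C (x i) (y j) := fun i j h =>
    Linked.not_disjoint_past h hxy
  have hno' : ∀ i j, ¬ LinkedVars C (y j) (x i) := fun i j h =>
    hno i j (Linked.symm h)
  change ((linkedBits C).map _) _ = ((linkedBits C).map _) _ * ((linkedBits C).map _) _
  rw [linkedBits_map_apply, linkedBits_map_apply, linkedBits_map_apply]
  -- No class meets both families, so the exponents of 1/2 add up.
  have hrange : (Set.range fun j => Quotient.mk (linkSetoid C) (Sum.elim x y j)).ncard =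
      (Set.range fun j => Quotient.mk (linkSetoid C) (x j)).ncard +
      (Set.range fun j => Quotient.mk (linkSetoid C) (y j)).ncard := by
    rw [← Set.ncard_union_eq, ← Set.Sum.elim_range]
    · congr 2
      funext j
      cases j <;> rfl
    · rw [Set.disjoint_iff_forall_ne]
      rintro _ ⟨i, rfl⟩ _ ⟨j, rfl⟩ e
      exact hno i j (Quotient.eq.1 e)
  rw [hrange, pow_add, ite_zero_mul_ite_zero]
  refine if_congr ⟨fun h => ⟨fun i j => h (.inl i) (.inl j), fun i j => h (.inr i) (.inr j)⟩, ?_⟩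
    rfl rfl
  rintro ⟨hx, hy⟩ (i | i) (j | j) hij
  · exact hx i j hij
  · exact absurd hij (hno i j)
  · exact absurd hij (hno' j i)
  · exact hy i j hij

theorem linkedTheory_coordinated :
    (linkedTheory System τ).Coordinated (circuit System τ) (output System τ) := by
  classical
  intro f
  have hlink : ∀ p q, LinkedVars (circuit System τ) (output System τ p) (output System τ q) :=
    fun p q => Or.inr ⟨id, p, q, fun w _ => ⟨rfl, rfl, rfl⟩, fun w _ => ⟨rfl, rfl, rfl⟩, rfl, rfl⟩
  refine (linkedBits_map_apply _ _ f).trans ?_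
  have hrange : (Set.range fun p => Quotient.mk (linkSetoid (circuit System τ))
      (output System τ p)) = {Quotient.mk _ (output System τ Party.A)} := by
    ext z
    constructor
    · rintro ⟨p, rfl⟩
      exact Quotient.eq.2 (hlink p _)
    · rintro rfl
      exact ⟨_, rfl⟩
  rw [hrange, Set.ncard_singleton, pow_one]
  simp only [hlink, true_imp_iff, one_div]

/-! ### Absence of a common cause. -/

theorem parties_subset_of_causes {m n : (components System τ).Comp}
    (h : (circuit System τ).Causes m n) : parties n ⊆ parties m := by
  have key : ∀ a b, (circuit System τ).Edge a b → parties b ⊆ parties a := by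
    rintro a b ⟨o, i, rfl, rfl, rfl⟩
    cases o with
    | toChannel s c hcs => exact hcs
    | toMeasurement c p hp => exact Finset.singleton_subset_iff.2 hp
  induction h with
  | single h => exact key _ _ h
  | tail _ h ih => exact (key _ _ h).trans ih

theorem not_hasCommonCause_output :
    ¬ (circuit System τ).HasCommonCause (output System τ) := by
  rintro ⟨n, hn⟩
  -- A common cause would concern all four parties, but no component concerns more than three.
  have hall : (Finset.univ : Finset Party) ⊆ parties n := fun p _ =>
    parties_subset_of_causes (hn p) (Finset.mem_singleton_self p)
  have h4 : 4 ≤ (parties n).card := Finset.card_le_card hall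
  have h3 : (parties n).card ≤ 3 := by
    match n with
    | .source s => exact s.2.le
    | .channel c => exact c.2.le.trans (by norm_num)
    | .measurement p => exact (Finset.card_singleton p).le.trans (by norm_num)
  omega

end FourParty

theorem mainTheorem2 (System : Type) (τ : FourParty.Wire → System) :
    Nat.card (FourParty.components System τ).Source = 4 ∧
    Nat.card (FourParty.components System τ).Channel = 6 ∧
    Nat.card (FourParty.components System τ).Measurement = 4 ∧
    ¬ (FourParty.circuit System τ).HasCommonCause (FourParty.output System τ) ∧
    ∃ T : OPT (FourParty.components System τ),
      T.NoSignaling ∧ T.Independence ∧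
      T.Coordinated (FourParty.circuit System τ) (FourParty.output System τ) ∧
      ¬ T.CoordinationPrinciple := by
  have hcard : ∀ k, Nat.card {s : Finset FourParty.Party // s.card = k} = Nat.choose 4 k := by
    intro k
    rw [Nat.card_eq_fintype_card, Fintype.card_finset_len]
    rfl
  refine ⟨hcard 3, hcard 2, Nat.card_eq_fintype_card (α := FourParty.Party),
    FourParty.not_hasCommonCause_output, FourParty.linkedTheory System τ,
    FourParty.linkedTheory_noSignaling, FourParty.linkedTheory_independence,
    FourParty.linkedTheory_coordinated, fun h => ?_⟩
  have : Nontrivial FourParty.Party := ⟨.A, .B, by decide⟩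
  refine FourParty.not_hasCommonCause_output
    (h _ FourParty.Party _ (fun p q e => ?_) FourParty.linkedTheory_coordinated)
  have e' := congrArg Subtype.val e
  injection e'
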